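/- **Setting.** Let $m\ge 2$, $n\ge 0$, let $C\in\{0,1\}^{m\times n}$ have nonzero columns $C_1,\dots,C_n$, and let $b\in\mathbb R^m$ have positive entries. For $k=1,\dots,n$ let $u_k$ be a concave utility function on $[0,\infty)$ which is real-valued on a convex set $D_k\subseteq[0,\infty)$ and equal to $-\infty$ elsewhere ($D_k=[0,\infty)$ if $u_k$ is finite everywhere). Put $D=\prod_k D_k$, $U(x)=\sum_{k=1}^n u_k(x_k)$, and consider $$\max\{U(x): x\in D,\ Cx\le b\},\qquad \varphi(\lambda)=\sup_{x\in D}\{U(x)+\langle\lambda,b-Cx\rangle\},\qquad \min_{\lambda\in\mathbb R^m_+}\varphi(\lambda).$$ Let $x^*$ be a solution of the first (primal) problem, assume Slater's condition (there is $x\in D$ with $Cx<b$ componentwise), and let $\lambda^*$ be a solution of the dual problem with $\|\lambda^*\|_2\le R$, where $R>0$. Let $\Lambda_{2R}=\{\lambda\in\mathbb R^m_+:\|\lambda\|_2\le 2R\}$. For each $\lambda\in\operatorname{int}\Lambda_{2R}$ let $x(\lambda)\in D$ be a vector of optimal responses, $x_k(\lambda)\in\arg\max_{y\in D_k}\{u_k(y)-y\langle\lambda,C_k\rangle\}$,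 and assume that the dual subgradients $\nabla\varphi(\lambda)=b-Cx(\lambda)$ satisfy $\|\nabla\varphi(\lambda)\|_2\le M$. For $\lambda\notin\operatorname{int}\Lambda_{2R}$ let a separation oracle give a vector $e(\lambda)\ne0$ with $\langle e(\lambda),\lambda-y\rangle\ge0$ for all $y\in\Lambda_{2R}$. Put $g(\lambda)=\nabla\varphi(\lambda)$ if $\lambda\in\operatorname{int}\Lambda_{2R}$, and $g(\lambda)=e(\lambda)$ otherwise. **Ellipsoid method.** Start with $\lambda^0=0$, $B_0=2R\cdot I_m$ (the ball of radius $2R$). At iteration $t$ let $g_t=g(\lambda^t)$. If $g_t=0$, the method stays at its state: $\lambda^{t+1}=\lambda^t$, $B_{t+1}=B_t$. Otherwise, with $q_t=B_t^\top g_t$ and $p_t=q_t/\|q_t\|_2$, $$B_{t+1}=\tfrac{m}{\sqrt{m^2-1}}B_t+\Big(\tfrac{m}{m+1}-\tfrac{m}{\sqrt{m^2-1}}\Big)B_tp_tp_t^\top,\qquad \lambda^{t+1}=\lambda^t-\tfrac1{m+1}B_tp_t .$$ **Certificate after $N$ iterations.** Let $I_N=\{t\le N-1:\lambda^t\in\operatorname{int}\Lambda_{2R}\}$.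 If $g_{N-1}=0$, put $\xi_{N-1}=1$ and $\xi_t=0$ for $t<N-1$. Otherwise take a singular value decomposition $B_N=U_N\operatorname{diag}(\sigma_1,\dots,\sigma_m)V_N$ with $U_N,V_N$ orthogonal and all $\sigma_i>0$, let $\sigma_{i_*}$ be the least $\sigma_i$, and let $h=\frac1{2\sigma_{i_*}}U_Ne_{i_*}$, where $e_{i_*}$ is the $i_*$-th standard basis vector. Starting with $w=h$, compute for $t=N-1,N-2,\dots,0$ $$\nu_t:=\frac{[w^\top B_tq_t]_+}{\|q_t\|_2^2},\qquad w:=w-\nu_tg_t,\qquad q_t=B_t^\top g_t,$$ and let $\mu_t$ be the coefficients obtained in the same way starting with $w=-h$. Put $\xi_t=(\nu_t+\mu_t)/\sum_{i\in I_N}(\nu_i+\mu_i)$ for $t\in I_N$, and $\xi_t=0$ for $t\notin I_N$. **Theorem 3.** Let $0<\varepsilon<128MR$ and $$N=2m(m+1)\left\lceil\ln\frac{32\cdot4MR}{\varepsilon}\right\rceil .$$ Then, for every choice of the optimal responses, of the separators and of the singular value decomposition as above, after $N$ iterations $\xi$ is an accuracy certificate, that is, $\xi_t\ge0$ and $\sum_{t=0}^{N-1}\xi_t=\sum_{t\in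 I_N}\xi_t=1$, and the point $\hat x^N=\sum_{t\in I_N}\xi_t\,x(\lambda^t)$ belongs to $D$ and satisfies $$U(x^*)-U(\hat x^N)\le\varepsilon,\qquad \big\|[C\hat x^N-b]_+\big\|_2\le\frac{\varepsilon}{R}.$$ -/

import Mathlib

open scoped Matrix

noncomputable section

namespace NUM

/-- Euclidean norm of a real vector. -/
def l2norm {ι : Type*} [Fintype ι] (v : ι → ℝ) : ℝ := ‖WithLp.toLp 2 v‖

/-- A network with `m` links and `n` users. `C` is the routing matrix (Boolean, with nonzero
columns), `b` the vector of link capacities. The utility of user `k` is the concave function equal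
to `u k` on the convex set `D k ⊆ [0, ∞)` of admissible rates and to `-∞` elsewhere; for a utility
that is finite everywhere, `D k = [0, ∞)`. -/
structure Network (m n : ℕ) where
  C : Matrix (Fin m) (Fin n) ℝ
  b : Fin m → ℝ
  D : Fin n → Set ℝ
  u : Fin n → ℝ → ℝ
  C_bool : ∀ j k, C j k = 0 ∨ C j k = 1
  C_col : ∀ k, ∃ j, C j k ≠ 0
  b_pos : ∀ j, 0 < b j
  D_nonneg : ∀ k, D k ⊆ Set.Ici 0
  u_concave : ∀ k, ConcaveOn ℝ (D k) (u k)

variable {m n : ℕ}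

/-- Rate vectors at which every utility is finite. -/
def Network.dom (P : Network m n) : Set (Fin n → ℝ) := {x | ∀ k, x k ∈ P.D k}

/-- Total utility `U(x) = ∑ₖ uₖ(xₖ)`. -/
def Network.U (P : Network m n) (x : Fin n → ℝ) : ℝ := ∑ k, P.u k (x k)

/-- Feasible set of the primal problem: admissible rates with `C x ≤ b`. -/
def Network.feasible (P : Network m n) : Set (Fin n → ℝ) :=
  {x | x ∈ P.dom ∧ ∀ j, (P.C *ᵥ x) j ≤ P.b j}

/-- `x` solves the primal problem `max {U(x) : C x ≤ b}`. -/
def Network.IsPrimalSolution (P : Network m n) (x : Fin n → ℝ) : Prop :=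
  x ∈ P.feasible ∧ IsMaxOn P.U P.feasible x

/-- Slater's condition. -/
def Network.Slater (P : Network m n) : Prop :=
  ∃ x ∈ P.dom, ∀ j, (P.C *ᵥ x) j < P.b j

/-- The dual function `φ(l) = sup_x {U(x) + ⟨l, b - C x⟩}`, with values in `[-∞, ∞]`. -/
def Network.dual (P : Network m n) (l : Fin m → ℝ) : EReal :=
  ⨆ x ∈ P.dom, ((P.U x + l ⬝ᵥ (P.b - P.C *ᵥ x) : ℝ) : EReal)

/-- `l` solves the dual problem `min {φ(l) : l ≥ 0}`. -/
def Network.IsDualSolution (P : Network m n) (l : Fin m → ℝ) : Prop :=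
  0 ≤ l ∧ IsMinOn P.dual {l' | 0 ≤ l'} l

/-- `x` is a vector of optimal responses to the prices `l`:
`xₖ ∈ argmax {uₖ(y) - y ⟨l, Cₖ⟩}` for every user `k`, where `Cₖ` is the `k`-th column of `C`. -/
def Network.IsResponse (P : Network m n) (l : Fin m → ℝ) (x : Fin n → ℝ) : Prop :=
  ∀ k, x k ∈ P.D k ∧ IsMaxOn (fun y => P.u k y - y * (l ⬝ᵥ P.C.col k)) (P.D k) (x k)

/-- The subgradient `b - C x(l)` of the dual function at `l` given by the responses `x`. -/
def Network.subgrad (P : Network m n) (x : (Fin m → ℝ) → Fin n → ℝ) (l : Fin m → ℝ) :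
    Fin m → ℝ :=
  P.b - P.C *ᵥ x l

/-- The set `{l ∈ ℝ₊ᵐ : ‖l‖₂ ≤ r}`. -/
def orthantBall (m : ℕ) (r : ℝ) : Set (Fin m → ℝ) := {l | 0 ≤ l ∧ l2norm l ≤ r}

/-- `sep` is a separation oracle for `X`: for every point `l` outside the interior of `X` it gives
a nonzero vector with `⟨sep l, l - y⟩ ≥ 0` for all `y ∈ X`. -/
def IsSeparationOracle (X : Set (Fin m → ℝ)) (sep : (Fin m → ℝ) → Fin m → ℝ) : Prop :=
  ∀ l, l ∉ interior X → sep l ≠ 0 ∧ ∀ y ∈ X, 0 ≤ sep l ⬝ᵥ (l - y)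

open Classical in
/-- The vector used by the method at `l`: the dual subgradient if `l` is in the interior of
`{l ≥ 0, ‖l‖₂ ≤ 2R}`, and a separator otherwise. -/
def Network.oracle (P : Network m n) (R : ℝ) (x : (Fin m → ℝ) → Fin n → ℝ)
    (sep : (Fin m → ℝ) → Fin m → ℝ) (l : Fin m → ℝ) : Fin m → ℝ :=
  if l ∈ interior (orthantBall m (2 * R)) then P.subgrad x l else sep l

/-- State of the ellipsoid method; it represents the ellipsoid `{B z + l : ‖z‖₂ ≤ 1}`. -/
structure State (m : ℕ) where
  B : Matrix (Fin m) (Fin m) ℝ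
  l : Fin m → ℝ

/-- The direction `p = Bᵀg / ‖Bᵀg‖₂`. -/
def State.dir (s : State m) (g : Fin m → ℝ) : Fin m → ℝ :=
  (l2norm (s.Bᵀ *ᵥ g))⁻¹ • (s.Bᵀ *ᵥ g)

open Classical in
/-- One iteration of the ellipsoid method with the vector `g`; the method stays where it is once
`g = 0` (the current point is then optimal). -/
def State.step (s : State m) (g : Fin m → ℝ) : State m :=
  if g = 0 then s else
    { B := ((m : ℝ) / √((m : ℝ) ^ 2 - 1)) • s.B +
        ((m : ℝ) / ((m : ℝ) + 1) - (m : ℝ) / √((m : ℝ) ^ 2 - 1)) •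
          (s.B * Matrix.vecMulVec (s.dir g) (s.dir g))
      l := s.l - (1 / ((m : ℝ) + 1)) • (s.B *ᵥ s.dir g) }

/-- The states of the ellipsoid method started from the ball of radius `r` centred at the origin,
where `g l` is the vector used at the point `l`. -/
def ellipsoid (r : ℝ) (g : (Fin m → ℝ) → Fin m → ℝ) : ℕ → State m
  | 0 => { B := r • (1 : Matrix (Fin m) (Fin m) ℝ), l := 0 }
  | t + 1 => (ellipsoid r g t).step (g (ellipsoid r g t).l)

/-- `h` comes from the narrowest strip of an ellipsoid with matrix `B`: for a singular value
decomposition `B = U diag(σ) V` with `U`, `V` orthogonal and `σ > 0`, and for an index `i` of the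
least `σᵢ`, one has `h = (1 / (2 σᵢ)) U eᵢ`. -/
def IsStripVector (B : Matrix (Fin m) (Fin m) ℝ) (h : Fin m → ℝ) : Prop :=
  ∃ U ∈ Matrix.orthogonalGroup (Fin m) ℝ, ∃ V ∈ Matrix.orthogonalGroup (Fin m) ℝ,
    ∃ σ : Fin m → ℝ, ∃ i : Fin m, (∀ j, 0 < σ j) ∧ (∀ j, σ i ≤ σ j) ∧
      B = U * Matrix.diagonal σ * V ∧ h = (1 / (2 * σ i)) • U.col i

/-- The coefficient `[wᵀ B q]₊ / ‖q‖₂²` with `q = Bᵀg`. -/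
def stripCoeff (B : Matrix (Fin m) (Fin m) ℝ) (g w : Fin m → ℝ) : ℝ :=
  max (w ⬝ᵥ (B *ᵥ (Bᵀ *ᵥ g))) 0 / l2norm (Bᵀ *ᵥ g) ^ 2

/-- `coeffs B g N w t` is the coefficient of index `t` produced by the loop that starts with the
vector `w` and, for `t = N - 1, N - 2, …, 0` in this order, computes
`cₜ := [wᵀ Bₜ qₜ]₊ / ‖qₜ‖₂²`, `qₜ = Bₜᵀ gₜ`, and replaces `w` by `w - cₜ gₜ`. -/
def coeffs (B : ℕ → Matrix (Fin m) (Fin m) ℝ) (g : ℕ → Fin m → ℝ) :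
    ℕ → (Fin m → ℝ) → ℕ → ℝ
  | 0, _ => fun _ => 0
  | N + 1, w =>
      Function.update (coeffs B g N (w - stripCoeff (B N) (g N) w • g N)) N
        (stripCoeff (B N) (g N) w)

open Classical in
/-- `I_N`: the iterations `t ≤ N - 1` whose point is in the interior of `X`. -/
def productive (X : Set (Fin m → ℝ)) (s : ℕ → State m) (N : ℕ) : Finset ℕ :=
  (Finset.range N).filter fun t => (s t).l ∈ interior X

open Classical in
/-- The accuracy certificate after `N` iterations with states `s` and vectors `g`, built from the
strip vector `h`. If the last vector is zero, all the weight is on `N - 1`; otherwise the weights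
are `(νₜ + μₜ) / ∑_{i ∈ I_N} (νᵢ + μᵢ)` on `I_N` (and zero elsewhere), `ν` and `μ` being the
coefficients obtained from `h` and `-h`. -/
def certificate (X : Set (Fin m → ℝ)) (s : ℕ → State m) (g : ℕ → Fin m → ℝ) (h : Fin m → ℝ)
    (N : ℕ) (t : ℕ) : ℝ :=
  if g (N - 1) = 0 then (if t = N - 1 then 1 else 0)
  else
    let B : ℕ → Matrix (Fin m) (Fin m) ℝ := fun i => (s i).B
    let w : ℕ → ℝ := fun i => coeffs B g N h i + coeffs B g N (-h) i
    if t ∈ productive X s N then w t / ∑ i ∈ productive X s N, w i else 0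

end NUM

end

/-! The ellipsoid `{B z + l : ‖z‖ ≤ 1}` is handled through its support function. One step of the
method satisfies a support inequality with an explicit multiplier for the cut
(`State.support_sub_stripCoeff_le`). Running the loop backwards composes these inequalities: a
linear bound valid on the last ellipsoid becomes a nonnegative combination of the cuts plus a bound
on the initial ball (`support_coeffs_le`, `sum_coeffs_le`). Apply this to `h` and `-h`, the normals
of the narrowest strip. Adding the two bounds cancels the linear terms, and separators may be
dropped since their cuts are nonnegative on the set; the unnormalized residual is at most 1. It
remains to show that the total weight is at least `1 / ε`. The determinant shrinks geometrically
(`det_ellipsoid`), so `h` is long (`IsStripVector.bounds`). The set is wide in every direction, so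
some point of it lies far outside the strip, and only productive cuts of bounded size can certify
this (`neg_le_sum_productive`). Finally, weak duality and concavity turn a residual of at most `ε`
into the primal bounds (`Network.approx_of_certificate`). -/

namespace NUM

/-! ### Euclidean norm and positive parts -/

section Euclidean

variable {ι : Type*} [Fintype ι]

lemma l2norm_nonneg (v : ι → ℝ) : 0 ≤ l2norm v := norm_nonneg _

lemma l2norm_sq (v : ι → ℝ) : l2norm v ^ 2 = v ⬝ᵥ v := by
  rw [l2norm, EuclideanSpace.norm_sq_eq]
  simp [dotProduct, sq]

@[simp]
lemma l2norm_zero : l2norm (0 : ι → ℝ) = 0 := by simp [l2norm]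

lemma l2norm_smul (c : ℝ) (v : ι → ℝ) : l2norm (c • v) = |c| * l2norm v := by
  rw [l2norm, WithLp.toLp_smul, norm_smul, Real.norm_eq_abs, l2norm]

lemma l2norm_neg (v : ι → ℝ) : l2norm (-v) = l2norm v := by
  rw [l2norm, WithLp.toLp_neg, norm_neg, l2norm]

lemma l2norm_sub_le (v w : ι → ℝ) : l2norm (v - w) ≤ l2norm v + l2norm w := by
  rw [l2norm, WithLp.toLp_sub]
  exact norm_sub_le _ _

lemma l2norm_eq_zero {v : ι → ℝ} : l2norm v = 0 ↔ v = 0 := by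
  rw [l2norm, norm_eq_zero, WithLp.toLp_eq_zero]

lemma l2norm_pos {v : ι → ℝ} (hv : v ≠ 0) : 0 < l2norm v :=
  (l2norm_nonneg v).lt_of_ne fun h => hv (l2norm_eq_zero.1 h.symm)

lemma abs_dotProduct_le (v w : ι → ℝ) : |v ⬝ᵥ w| ≤ l2norm v * l2norm w := by
  have h := abs_real_inner_le_norm (WithLp.toLp 2 w) (WithLp.toLp 2 v)
  rw [EuclideanSpace.inner_toLp_toLp] at h
  simpa [l2norm, mul_comm] using h

lemma dotProduct_le (v w : ι → ℝ) : v ⬝ᵥ w ≤ l2norm v * l2norm w :=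
  (le_abs_self _).trans (abs_dotProduct_le v w)

/-- The componentwise positive part. -/
def posPart {ι : Type*} (v : ι → ℝ) : ι → ℝ := fun i => max (v i) 0

lemma posPart_nonneg {ι : Type*} (v : ι → ℝ) : 0 ≤ posPart v := fun _ => le_max_right _ _

lemma dotProduct_posPart (v : ι → ℝ) : v ⬝ᵥ posPart v = l2norm (posPart v) ^ 2 := by
  rw [l2norm_sq]
  refine Finset.sum_congr rfl fun i _ => ?_
  rcases le_total (v i) 0 with h | h <;> simp [posPart, h]

lemma dotProduct_le_posPart {l : ι → ℝ} (hl : 0 ≤ l) (v : ι → ℝ) :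
    l ⬝ᵥ v ≤ l2norm l * l2norm (posPart v) :=
  (Finset.sum_le_sum fun i _ => mul_le_mul_of_nonneg_left (le_max_left _ _) (hl i)).trans
    (dotProduct_le l (posPart v))

lemma posPart_sub_posPart_neg {ι : Type*} (v : ι → ℝ) : posPart v - posPart (-v) = v := by
  ext i
  rcases le_total (v i) 0 with h | h <;> simp [posPart, h]

lemma l2norm_le_posPart_add (v : ι → ℝ) :
    l2norm v ≤ l2norm (posPart v) + l2norm (posPart (-v)) := by
  conv_lhs => rw [← posPart_sub_posPart_neg v]
  exact l2norm_sub_le _ _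

end Euclidean

variable {m n : ℕ}

/-! ### Extent of the ball intersected with the orthant -/

lemma zero_mem_orthantBall {r : ℝ} (hr : 0 ≤ r) : (0 : Fin m → ℝ) ∈ orthantBall m r :=
  ⟨le_rfl, by simpa using hr⟩

/-- The support function of the part of a ball in the nonnegative orthant is attained. -/
lemma exists_mem_orthantBall_dotProduct_eq {r : ℝ} (hr : 0 ≤ r) (v : Fin m → ℝ) :
    ∃ y ∈ orthantBall m r, v ⬝ᵥ y = r * l2norm (posPart v) := by
  by_cases h : posPart v = 0
  · exact ⟨0, zero_mem_orthantBall hr, by simp [h]⟩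
  · have hp := l2norm_pos h
    refine ⟨(r / l2norm (posPart v)) • posPart v,
      ⟨smul_nonneg (div_nonneg hr hp.le) (posPart_nonneg v), ?_⟩, ?_⟩
    · rw [l2norm_smul, abs_of_nonneg (div_nonneg hr hp.le), div_mul_cancel₀ _ hp.ne']
    · rw [dotProduct_smul, dotProduct_posPart, smul_eq_mul]
      field_simp

/-- In every direction the width of the part of a ball of radius `r` in the nonnegative orthant is
at least `r`. -/
lemma exists_mem_orthantBall_abs_dotProduct_ge {r : ℝ} (hr : 0 ≤ r) (v c : Fin m → ℝ) :
    ∃ y ∈ orthantBall m r, r / 2 * l2norm v ≤ |v ⬝ᵥ (c - y)| := by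
  obtain ⟨y, hy, hvy⟩ := exists_mem_orthantBall_dotProduct_eq hr v
  obtain ⟨z, hz, hvz⟩ := exists_mem_orthantBall_dotProduct_eq hr (-v)
  -- `y` maximizes and `z` minimizes `⟨v, ·⟩`; their values differ by `r (‖v⁺‖ + ‖v⁻‖) ≥ r ‖v‖`, so
  -- one of them is at least half of that away from the value at `c`.
  by_contra! hcon
  have h1 := (abs_lt.1 (hcon y hy)).1
  have h2 := (abs_lt.1 (hcon z hz)).2
  rw [neg_dotProduct] at hvz
  rw [dotProduct_sub] at h1 h2
  have := mul_le_mul_of_nonneg_left (l2norm_le_posPart_add v) hr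
  linarith

/-! ### One step of the ellipsoid method -/

/-- The support function of the ellipsoid `{B z + l : ‖z‖₂ ≤ 1}`. -/
noncomputable def State.support (s : State m) (w : Fin m → ℝ) : ℝ := w ⬝ᵥ s.l + l2norm (s.Bᵀ *ᵥ w)

lemma one_lt_sq_cast (hm : 2 ≤ m) : (1 : ℝ) < (m : ℝ) ^ 2 := by
  have : (2 : ℝ) ≤ m := by exact_mod_cast hm
  nlinarith

lemma stretch_sq (hm : 2 ≤ m) :
    ((m : ℝ) / √((m : ℝ) ^ 2 - 1)) ^ 2 = 1 + 1 / ((m : ℝ) ^ 2 - 1) := by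
  have h := one_lt_sq_cast hm
  have h' : (m : ℝ) ^ 2 - 1 ≠ 0 := by linarith
  rw [div_pow, Real.sq_sqrt (by linarith)]
  field_simp
  ring

/-- A half of the unit ball is contained in the ellipsoid of the next step, in terms of support
functions. -/
lemma l2norm_sub_posPart_le (hm : 2 ≤ m) {p : Fin m → ℝ} (hp : p ⬝ᵥ p = 1) (v : Fin m → ℝ) :
    l2norm (v - max (p ⬝ᵥ v) 0 • p) + 1 / ((m : ℝ) + 1) * (p ⬝ᵥ v) ≤
      l2norm (((m : ℝ) / √((m : ℝ) ^ 2 - 1)) • v +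
        ((m : ℝ) / ((m : ℝ) + 1) - (m : ℝ) / √((m : ℝ) ^ 2 - 1)) • (p ⬝ᵥ v) • p) := by
  have hα := stretch_sq hm
  have hm1 : (0 : ℝ) < (m : ℝ) + 1 := by positivity
  have hm2 := one_lt_sq_cast hm
  set α := (m : ℝ) / √((m : ℝ) ^ 2 - 1)
  set k := 1 / ((m : ℝ) + 1) with hk
  set d := 1 / ((m : ℝ) ^ 2 - 1) with hd
  have hβ : (m : ℝ) / ((m : ℝ) + 1) = 1 - k := by rw [hk]; field_simp; ring
  have hk0 : 0 < k := by positivity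
  have hd0 : 0 < d := one_div_pos.2 (by linarith)
  -- The zero-discriminant relation: it makes the quadratic form in the case `0 ≤ a` a perfect
  -- square after multiplication by `d`.
  have hkd : k ^ 2 = d * (1 - 2 * k) := by
    have : (m : ℝ) ^ 2 - 1 ≠ 0 := by linarith
    rw [hk, hd]; field_simp; ring
  rw [hβ]
  set a := p ⬝ᵥ v with ha
  have hvp : v ⬝ᵥ p = a := dotProduct_comm _ _
  set Y := l2norm (α • v + (1 - k - α) • a • p) with hY
  have hY2 : Y ^ 2 = (1 + d) * (v ⬝ᵥ v - a ^ 2) + (1 - k) ^ 2 * a ^ 2 := by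
    rw [hY, l2norm_sq, ← hα]
    simp only [add_dotProduct, dotProduct_add, smul_dotProduct, dotProduct_smul, smul_eq_mul, hp,
      hvp, ← ha]
    ring
  have hproj : ∀ c : ℝ, l2norm (v - c • p) ^ 2 = v ⬝ᵥ v - 2 * c * a + c ^ 2 := by
    intro c
    rw [l2norm_sq]
    simp only [sub_dotProduct, dotProduct_sub, smul_dotProduct, dotProduct_smul, smul_eq_mul, hp,
      hvp, ← ha]
    ring
  have hc := hproj a
  have hX := hproj (max a 0)
  have hX0 := l2norm_nonneg (v - max a 0 • p)
  set X := l2norm (v - max a 0 • p)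
  have hva : 0 ≤ v ⬝ᵥ v - a ^ 2 := by nlinarith [sq_nonneg (l2norm (v - a • p))]
  refine (le_abs_self _).trans (abs_le_of_sq_le_sq ?_ (l2norm_nonneg _))
  rw [hY2]
  rcases le_total a 0 with h | h
  · rw [max_eq_right h] at hX
    have hXa : -a ≤ X := (neg_le_abs a).trans (abs_le_of_sq_le_sq (by linarith) hX0)
    have h1 : 0 ≤ k * (-a) * (X + a) := by
      apply mul_nonneg (mul_nonneg hk0.le _) <;> linarith
    nlinarith [mul_nonneg hd0.le hva]
  · rw [max_eq_left h] at hX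
    have h1 : v ⬝ᵥ v - a ^ 2 = X ^ 2 := by linarith
    rw [h1]
    have h2 : 0 ≤ d * (d * X ^ 2 - 2 * k * X * a + (1 - 2 * k) * a ^ 2) := by
      have : d * (d * X ^ 2 - 2 * k * X * a + (1 - 2 * k) * a ^ 2) = (d * X - k * a) ^ 2 := by
        linear_combination -a ^ 2 * hkd
      rw [this]; positivity
    have h3 := nonneg_of_mul_nonneg_right h2 hd0
    nlinarith

lemma State.dir_dotProduct_self {s : State m} {g : Fin m → ℝ} (hq : s.Bᵀ *ᵥ g ≠ 0) :
    s.dir g ⬝ᵥ s.dir g = 1 := by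
  have h := l2norm_pos hq
  rw [State.dir, smul_dotProduct, dotProduct_smul, ← l2norm_sq, smul_eq_mul, smul_eq_mul]
  field_simp

lemma stripCoeff_nonneg (B : Matrix (Fin m) (Fin m) ℝ) (g w : Fin m → ℝ) :
    0 ≤ stripCoeff B g w := div_nonneg (le_max_right _ _) (sq_nonneg _)

lemma stripCoeff_smul {s : State m} {g : Fin m → ℝ} (hq : s.Bᵀ *ᵥ g ≠ 0) (w : Fin m → ℝ) :
    stripCoeff s.B g w • (s.Bᵀ *ᵥ g) = max (s.dir g ⬝ᵥ (s.Bᵀ *ᵥ w)) 0 • s.dir g := by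
  have h := l2norm_pos hq
  have h1 : w ⬝ᵥ (s.B *ᵥ (s.Bᵀ *ᵥ g)) = (s.Bᵀ *ᵥ g) ⬝ᵥ (s.Bᵀ *ᵥ w) := by
    rw [Matrix.dotProduct_mulVec, Matrix.mulVec_transpose s.B w, dotProduct_comm]
  have h2 : max ((l2norm (s.Bᵀ *ᵥ g))⁻¹ * ((s.Bᵀ *ᵥ g) ⬝ᵥ (s.Bᵀ *ᵥ w))) 0 =
      (l2norm (s.Bᵀ *ᵥ g))⁻¹ * max ((s.Bᵀ *ᵥ g) ⬝ᵥ (s.Bᵀ *ᵥ w)) 0 := by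
    rw [mul_max_of_nonneg _ _ (inv_nonneg.2 h.le), mul_zero]
  rw [stripCoeff, h1, State.dir, smul_dotProduct, smul_eq_mul, h2, smul_smul]
  congr 1
  field_simp

/-- Dual form of the inclusion of the half-ellipsoid in the next ellipsoid. Passing to `Bᵀ w`
reduces it to the unit ball, where the multiplier removes the positive part of the component along
the cut direction. -/
lemma State.support_sub_stripCoeff_le (hm : 2 ≤ m) (s : State m) (g w : Fin m → ℝ) :
    s.support (w - stripCoeff s.B g w • g) + stripCoeff s.B g w * (g ⬝ᵥ s.l) ≤
      (s.step g).support w := by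
  have hsum : s.support (w - stripCoeff s.B g w • g) + stripCoeff s.B g w * (g ⬝ᵥ s.l) =
      w ⬝ᵥ s.l + l2norm (s.Bᵀ *ᵥ w - stripCoeff s.B g w • (s.Bᵀ *ᵥ g)) := by
    rw [State.support, Matrix.mulVec_sub, Matrix.mulVec_smul, sub_dotProduct, smul_dotProduct,
      smul_eq_mul]
    ring
  rw [hsum]
  by_cases hg : g = 0
  · simp [State.step, hg, State.support]
  have hl : (s.step g).l = s.l - (1 / ((m : ℝ) + 1)) • (s.B *ᵥ s.dir g) := by
    simp [State.step, hg]
  have hB : (s.step g).Bᵀ *ᵥ w = ((m : ℝ) / √((m : ℝ) ^ 2 - 1)) • (s.Bᵀ *ᵥ w) +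
      ((m : ℝ) / ((m : ℝ) + 1) - (m : ℝ) / √((m : ℝ) ^ 2 - 1)) •
        (s.dir g ⬝ᵥ (s.Bᵀ *ᵥ w)) • s.dir g := by
    simp only [State.step, hg, if_false, Matrix.transpose_add, Matrix.transpose_smul,
      Matrix.transpose_mul, Matrix.transpose_vecMulVec, Matrix.add_mulVec, Matrix.smul_mulVec,
      ← Matrix.mulVec_mulVec, Matrix.vecMulVec_mulVec]
    simp
  have hw : w ⬝ᵥ (s.B *ᵥ s.dir g) = s.dir g ⬝ᵥ (s.Bᵀ *ᵥ w) := by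
    rw [Matrix.dotProduct_mulVec, Matrix.mulVec_transpose s.B w, dotProduct_comm]
  rw [State.support, hl, hB, dotProduct_sub, dotProduct_smul, hw, smul_eq_mul]
  by_cases hq : s.Bᵀ *ᵥ g = 0
  -- Here the direction and the coefficient are both zero (division by zero), and the step only
  -- stretches `B` by a factor at least 1.
  · have h1 : (1 : ℝ) ≤ |(m : ℝ) / √((m : ℝ) ^ 2 - 1)| := by
      rw [← one_le_sq_iff_one_le_abs, stretch_sq hm, le_add_iff_nonneg_right]
      exact one_div_nonneg.2 (by linarith [one_lt_sq_cast hm])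
    have h2 := le_mul_of_one_le_left (l2norm_nonneg (s.Bᵀ *ᵥ w)) h1
    simpa [State.dir, hq, l2norm_smul] using h2
  · rw [stripCoeff_smul hq]
    linarith [l2norm_sub_posPart_le hm (State.dir_dotProduct_self hq) (s.Bᵀ *ᵥ w)]

/-- The update is a rank-one perturbation of a multiple of the identity, so the determinant is
scaled by `α ^ (m - 1) * β`; `1 + x ≤ exp x` bounds both `α ^ 2` and `β`. -/
lemma det_step {s : State m} (hm : 2 ≤ m) {g : Fin m → ℝ} (hg : g ≠ 0) (hs : 0 < s.B.det) :
    0 < (s.step g).B.det ∧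
      (s.step g).B.det ≤ Real.exp (-(1 / (2 * ((m : ℝ) + 1)))) * s.B.det := by
  have hα2 := stretch_sq hm
  have hm2 := one_lt_sq_cast hm
  have hα0 : 0 < (m : ℝ) / √((m : ℝ) ^ 2 - 1) :=
    div_pos (by positivity) (Real.sqrt_pos.2 (by linarith))
  have hq : s.Bᵀ *ᵥ g ≠ 0 := by
    intro h0
    refine hg (Matrix.eq_zero_of_mulVec_eq_zero (M := s.Bᵀ) ?_ h0)
    rw [Matrix.det_transpose]; exact hs.ne'
  have hp := State.dir_dotProduct_self hq
  set α := (m : ℝ) / √((m : ℝ) ^ 2 - 1) with hα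
  set β := (m : ℝ) / ((m : ℝ) + 1) with hβ
  have hβ0 : 0 < β := by positivity
  have hfac : (s.step g).B =
      s.B * (α • (1 + Matrix.vecMulVec (((β - α) / α) • s.dir g) (s.dir g))) := by
    simp only [State.step, hg, if_false]
    rw [Matrix.smul_vecMulVec, smul_add, smul_smul, mul_div_cancel₀ _ hα0.ne', Matrix.mul_add,
      Matrix.mul_smul, Matrix.mul_smul, mul_one]
  have hdet : (s.step g).B.det = α ^ (m - 1) * β * s.B.det := by
    rw [hfac, Matrix.det_mul, Matrix.det_smul, Matrix.vecMulVec_eq Unit,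
      Matrix.det_one_add_replicateCol_mul_replicateRow, dotProduct_smul, hp,
      Fintype.card_fin]
    obtain ⟨k, rfl⟩ : ∃ k, m = k + 1 := ⟨m - 1, by omega⟩
    simp only [Nat.add_sub_cancel, smul_eq_mul, mul_one, pow_succ]
    field_simp
    ring
  have hpos : 0 < α ^ (m - 1) * β := by positivity
  rw [hdet]
  refine ⟨mul_pos hpos hs, mul_le_mul_of_nonneg_right ?_ hs.le⟩
  have hαe : α ≤ Real.exp (1 / (2 * ((m : ℝ) ^ 2 - 1))) := by
    refine (le_abs_self α).trans (abs_le_of_sq_le_sq ?_ (Real.exp_pos _).le)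
    rw [hα2, ← Real.exp_nat_mul, add_comm]
    refine (Real.add_one_le_exp _).trans (le_of_eq ?_)
    congr 1
    push_cast
    rw [mul_one_div, mul_comm 2 ((m : ℝ) ^ 2 - 1), ← div_div]
    field_simp
  have hβe : β ≤ Real.exp (-(1 / ((m : ℝ) + 1))) := by
    refine le_trans (le_of_eq ?_) (Real.add_one_le_exp _)
    rw [hβ]; field_simp; ring
  calc α ^ (m - 1) * β
      ≤ Real.exp (1 / (2 * ((m : ℝ) ^ 2 - 1))) ^ (m - 1) * Real.exp (-(1 / ((m : ℝ) + 1))) := by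
        gcongr
    _ = Real.exp (-(1 / (2 * ((m : ℝ) + 1)))) := by
        rw [← Real.exp_nat_mul, ← Real.exp_add]
        congr 1
        have h1 : (m : ℝ) ^ 2 - 1 ≠ 0 := by linarith
        have h1 : (m : ℝ) - 1 ≠ 0 := by
          intro h; apply h1; linear_combination ((m : ℝ) + 1) * h
        rw [Nat.cast_sub (by omega), Nat.cast_one,
          show (m : ℝ) ^ 2 - 1 = (m - 1) * (m + 1) by ring]
        field_simp
        ring

/-! ### The certificate -/

lemma coeffs_nonneg (B : ℕ → Matrix (Fin m) (Fin m) ℝ) (g : ℕ → Fin m → ℝ) (N : ℕ)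
    (w : Fin m → ℝ) (t : ℕ) : 0 ≤ coeffs B g N w t := by
  induction N generalizing w with
  | zero => exact le_rfl
  | succ N ih =>
    rw [coeffs]
    rcases eq_or_ne t N with rfl | h
    · rw [Function.update_self]; exact stripCoeff_nonneg _ _ _
    · rw [Function.update_of_ne h]; exact ih _

/-- The loop expresses the inequality given by the last ellipsoid as a consequence of the cuts and
of the inclusion in the first ellipsoid. -/
lemma support_coeffs_le (hm : 2 ≤ m) {s : ℕ → State m} {g : ℕ → Fin m → ℝ}
    (hs : ∀ t, s (t + 1) = (s t).step (g t)) (N : ℕ) (w : Fin m → ℝ) :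
    (s 0).support (w - ∑ t ∈ Finset.range N, coeffs (fun i => (s i).B) g N w t • g t) +
      ∑ t ∈ Finset.range N, coeffs (fun i => (s i).B) g N w t * (g t ⬝ᵥ (s t).l) ≤
      (s N).support w := by
  -- The loop treats the last cut first, so it is peeled off and the hypothesis is used at the
  -- reduced vector.
  induction N generalizing w with
  | zero => simp
  | succ N ih =>
    have hne : ∀ t ∈ Finset.range N, coeffs (fun i => (s i).B) g (N + 1) w t =
        coeffs (fun i => (s i).B) g N (w - stripCoeff (s N).B (g N) w • g N) t := by
      intro t ht
      rw [coeffs, Function.update_of_ne (Finset.mem_range.1 ht).ne]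
    have hN : coeffs (fun i => (s i).B) g (N + 1) w N = stripCoeff (s N).B (g N) w := by
      rw [coeffs, Function.update_self]
    rw [Finset.sum_range_succ, Finset.sum_range_succ, hN,
      Finset.sum_congr rfl fun t ht => by rw [hne t ht],
      Finset.sum_congr rfl fun t ht => congrArg (· * (g t ⬝ᵥ (s t).l)) (hne t ht), hs N]
    have h1 := ih (w - stripCoeff (s N).B (g N) w • g N)
    have h2 := (s N).support_sub_stripCoeff_le hm (g N) w
    rw [sub_sub, add_comm (stripCoeff (s N).B (g N) w • g N)] at h1
    linarith

lemma ellipsoid_succ (r : ℝ) (g : (Fin m → ℝ) → Fin m → ℝ) (t : ℕ) :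
    ellipsoid r g (t + 1) = (ellipsoid r g t).step (g (ellipsoid r g t).l) := rfl

lemma sum_coeffs_le (hm : 2 ≤ m) {r : ℝ} (hr : 0 ≤ r) (g : (Fin m → ℝ) → Fin m → ℝ)
    {s : ℕ → State m} (hs : s = ellipsoid r g) (N : ℕ) (w : Fin m → ℝ) {y : Fin m → ℝ}
    (hy : l2norm y ≤ r) :
    ∑ t ∈ Finset.range N, coeffs (fun i => (s i).B) (fun i => g (s i).l) N w t *
        (g (s t).l ⬝ᵥ ((s t).l - y)) ≤
      l2norm ((s N).Bᵀ *ᵥ w) + w ⬝ᵥ ((s N).l - y) := by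
  have h := support_coeffs_le hm (s := s) (g := fun i => g (s i).l)
    (by rw [hs]; exact ellipsoid_succ r g) N w
  set c := coeffs (fun i => (s i).B) (fun i => g (s i).l) N w
  set v := w - ∑ t ∈ Finset.range N, c t • g (s t).l with hv
  have h0 : v ⬝ᵥ y ≤ (s 0).support v := by
    have : (s 0).support v = r * l2norm v := by
      rw [State.support, hs]
      simp [ellipsoid, Matrix.smul_mulVec, l2norm_smul, abs_of_nonneg hr]
    rw [this, mul_comm]
    exact (dotProduct_le v y).trans (mul_le_mul_of_nonneg_left hy (l2norm_nonneg v))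
  have h1 : v ⬝ᵥ y = w ⬝ᵥ y - ∑ t ∈ Finset.range N, c t * (g (s t).l ⬝ᵥ y) := by
    rw [hv, sub_dotProduct, sum_dotProduct]
    simp [smul_dotProduct]
  simp only [dotProduct_sub, mul_sub, Finset.sum_sub_distrib]
  rw [State.support.eq_1 (s N)] at h
  linarith

lemma ellipsoid_stays {r : ℝ} {g : (Fin m → ℝ) → Fin m → ℝ} {t t' : ℕ} (ht : t ≤ t')
    (h : g (ellipsoid r g t).l = 0) : g (ellipsoid r g t').l = 0 := by
  induction t', ht using Nat.le_induction with
  | base => exact h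
  | succ k _ ih => rw [ellipsoid_succ, State.step, if_pos ih]; exact ih

lemma det_ellipsoid (hm : 2 ≤ m) {r : ℝ} (hr : 0 < r) {g : (Fin m → ℝ) → Fin m → ℝ} (N : ℕ)
    (hg : ∀ t < N, g (ellipsoid r g t).l ≠ 0) :
    0 < (ellipsoid r g N).B.det ∧
      (ellipsoid r g N).B.det ≤ Real.exp (-(1 / (2 * ((m : ℝ) + 1)))) ^ N * r ^ m := by
  induction N with
  | zero => simp [ellipsoid, hr]
  | succ N ih =>
    obtain ⟨h0, h1⟩ := ih fun t ht => hg t (by omega)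
    obtain ⟨h2, h3⟩ := det_step hm (hg N (by omega)) h0
    refine ⟨h2, h3.trans ?_⟩
    rw [pow_succ', mul_assoc]
    exact mul_le_mul_of_nonneg_left h1 (Real.exp_pos _).le

lemma l2norm_mulVec_orthogonal {U : Matrix (Fin m) (Fin m) ℝ}
    (hU : U ∈ Matrix.orthogonalGroup (Fin m) ℝ) (v : Fin m → ℝ) : l2norm (U *ᵥ v) = l2norm v := by
  rw [← sq_eq_sq₀ (l2norm_nonneg _) (l2norm_nonneg _), l2norm_sq, l2norm_sq,
    Matrix.dotProduct_mulVec, ← Matrix.mulVec_transpose, Matrix.mulVec_mulVec]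
  have : Uᵀ * U = 1 := (Matrix.mem_orthogonalGroup_iff' (Fin m) ℝ).1 hU
  rw [this, Matrix.one_mulVec]

/-- The strip orthogonal to a strip vector contains the ellipsoid, and its width is controlled by
the determinant. -/
lemma IsStripVector.bounds {B : Matrix (Fin m) (Fin m) ℝ} {h : Fin m → ℝ} (hh : IsStripVector B h)
    {ρ : ℝ} (hρ : 0 < ρ) (hB : |B.det| ≤ ρ ^ m) :
    l2norm (Bᵀ *ᵥ h) = 1 / 2 ∧ 1 / (2 * ρ) ≤ l2norm h := by
  obtain ⟨U, hU, V, hV, σ, i, hσ, hi, rfl, rfl⟩ := hh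
  have hUU : Uᵀ * U = 1 := (Matrix.mem_orthogonalGroup_iff' (Fin m) ℝ).1 hU
  have hVt : Vᵀ ∈ Matrix.orthogonalGroup (Fin m) ℝ := by
    rw [Matrix.mem_orthogonalGroup_iff, Matrix.transpose_transpose]
    exact (Matrix.mem_orthogonalGroup_iff' (Fin m) ℝ).1 hV
  have hcol : U.col i = U *ᵥ Pi.single i 1 := (Matrix.mulVec_single_one U i).symm
  have hsingle : l2norm (Pi.single i 1 : Fin m → ℝ) = 1 := by
    rw [← sq_eq_sq₀ (l2norm_nonneg _) zero_le_one, l2norm_sq]; simp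
  have hσi := hσ i
  constructor
  · rw [Matrix.mulVec_smul, hcol, Matrix.transpose_mul, Matrix.transpose_mul,
      Matrix.diagonal_transpose, Matrix.mulVec_mulVec, Matrix.mul_assoc, Matrix.mul_assoc, hUU,
      mul_one, ← Matrix.mulVec_mulVec, l2norm_smul, l2norm_mulVec_orthogonal hVt,
      Matrix.diagonal_mulVec_single, mul_one,
      show (Pi.single i (σ i) : Fin m → ℝ) = σ i • Pi.single i 1 by
        rw [← Pi.single_smul, smul_eq_mul, mul_one],
      l2norm_smul, hsingle, abs_of_pos hσi, abs_of_pos (by positivity)]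
    field_simp
  · rw [l2norm_smul, hcol, l2norm_mulVec_orthogonal hU, hsingle, mul_one,
      abs_of_pos (by positivity)]
    have hdetO : ∀ W ∈ Matrix.orthogonalGroup (Fin m) ℝ, |W.det| = 1 := by
      intro W hW
      have : (Wᵀ * W).det = _ :=
        congrArg Matrix.det ((Matrix.mem_orthogonalGroup_iff' (Fin m) ℝ).1 hW)
      rw [Matrix.det_mul, Matrix.det_transpose, Matrix.det_one, ← sq, ← sq_abs] at this
      exact (pow_eq_one_iff_of_nonneg (abs_nonneg _) two_ne_zero).1 this
    rw [Matrix.det_mul, Matrix.det_mul, abs_mul, abs_mul, hdetO U hU, hdetO V hV, one_mul, mul_one,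
      Matrix.det_diagonal, abs_of_pos (Finset.prod_pos fun j _ => hσ j)] at hB
    -- `|det B|` is the product of the singular values, each at least `σ i`.
    have h1 : σ i ^ m ≤ ρ ^ m := by
      refine le_trans ?_ hB
      simpa using Finset.prod_le_prod (s := Finset.univ) (fun j _ => hσi.le) fun j _ => hi j
    have h2 : σ i ≤ ρ := le_of_pow_le_pow_left₀ (Fin.pos i).ne' hρ.le h1
    gcongr

/-! ### Duality -/

lemma Network.IsResponse.mem_dom {P : Network m n} {l : Fin m → ℝ} {y : Fin n → ℝ}
    (hy : P.IsResponse l y) : y ∈ P.dom := fun k => (hy k).1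

lemma Network.IsResponse.le {P : Network m n} {l : Fin m → ℝ} {y : Fin n → ℝ}
    (hy : P.IsResponse l y) {z : Fin n → ℝ} (hz : z ∈ P.dom) :
    P.U z + l ⬝ᵥ (P.b - P.C *ᵥ z) ≤ P.U y + l ⬝ᵥ (P.b - P.C *ᵥ y) := by
  have key : ∀ v : Fin n → ℝ, P.U v + l ⬝ᵥ (P.b - P.C *ᵥ v) =
      ∑ k, (P.u k (v k) - v k * (l ⬝ᵥ P.C.col k)) + l ⬝ᵥ P.b := by
    intro v
    have h : l ⬝ᵥ (P.C *ᵥ v) = ∑ k, v k * (l ⬝ᵥ P.C.col k) := by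
      rw [Matrix.dotProduct_mulVec]
      exact Finset.sum_congr rfl fun k _ => mul_comm _ _
    rw [dotProduct_sub, h, Network.U, Finset.sum_sub_distrib]
    ring
  rw [key, key]
  exact add_le_add_left (Finset.sum_le_sum fun k _ => (hy k).2 (hz k)) _

/-- Weak duality at the optimal multiplier, with the dual value bounded by that at a point where
optimal responses exist. -/
lemma Network.IsDualSolution.le {P : Network m n} {lopt l : Fin m → ℝ} {y z : Fin n → ℝ}
    (hopt : P.IsDualSolution lopt) (hl : 0 ≤ l) (hy : P.IsResponse l y) (hz : z ∈ P.dom) :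
    P.U z + lopt ⬝ᵥ (P.b - P.C *ᵥ z) ≤ P.U y + l ⬝ᵥ (P.b - P.C *ᵥ y) := by
  have h1 : ((P.U z + lopt ⬝ᵥ (P.b - P.C *ᵥ z) : ℝ) : EReal) ≤ P.dual lopt :=
    le_iSup₂ (f := fun x (_ : x ∈ P.dom) =>
      ((P.U x + lopt ⬝ᵥ (P.b - P.C *ᵥ x) : ℝ) : EReal)) z hz
  have h2 : P.dual lopt ≤ P.dual l := hopt.2 hl
  have h3 : P.dual l ≤ ((P.U y + l ⬝ᵥ (P.b - P.C *ᵥ y) : ℝ) : EReal) :=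
    iSup₂_le fun x hx => EReal.coe_le_coe_iff.2 (hy.le hx)
  exact EReal.coe_le_coe_iff.1 (h1.trans (h2.trans h3))

/-! ### From a certificate to an approximate primal solution -/

section Average

variable {ι : Type*} {I : Finset ι} {ξ : ι → ℝ} {y : ι → Fin n → ℝ}

lemma Network.sum_smul_mem_dom (P : Network m n) (hξ0 : ∀ t ∈ I, 0 ≤ ξ t)
    (hξ1 : ∑ t ∈ I, ξ t = 1) (hy : ∀ t ∈ I, y t ∈ P.dom) : ∑ t ∈ I, ξ t • y t ∈ P.dom := by
  intro k
  rw [Finset.sum_apply]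
  exact (P.u_concave k).1.sum_mem hξ0 hξ1 fun t ht => hy t ht k

lemma Network.sum_mul_U_le (P : Network m n) (hξ0 : ∀ t ∈ I, 0 ≤ ξ t)
    (hξ1 : ∑ t ∈ I, ξ t = 1) (hy : ∀ t ∈ I, y t ∈ P.dom) :
    ∑ t ∈ I, ξ t * P.U (y t) ≤ P.U (∑ t ∈ I, ξ t • y t) := by
  simp only [Network.U, Finset.mul_sum]
  rw [Finset.sum_comm]
  refine Finset.sum_le_sum fun k _ => ?_
  rw [Finset.sum_apply]
  exact (P.u_concave k).le_map_sum hξ0 hξ1 fun t ht => hy t ht k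

/-- An accuracy certificate with residual `ε` gives an approximate primal solution. -/
lemma Network.approx_of_certificate {P : Network m n} {R ε : ℝ} (hR : 0 < R)
    {xopt : Fin n → ℝ} (hxopt : P.IsPrimalSolution xopt) {lopt : Fin m → ℝ}
    (hlopt : P.IsDualSolution lopt) (hloptR : l2norm lopt ≤ R)
    (hξ0 : ∀ t ∈ I, 0 ≤ ξ t) (hξ1 : ∑ t ∈ I, ξ t = 1) {l : ι → Fin m → ℝ}
    (hl : ∀ t ∈ I, 0 ≤ l t) (hy : ∀ t ∈ I, P.IsResponse (l t) (y t))
    (hcert : ∀ z ∈ orthantBall m (2 * R),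
      ∑ t ∈ I, ξ t * ((P.b - P.C *ᵥ y t) ⬝ᵥ (l t - z)) ≤ ε) :
    P.U xopt - P.U (∑ t ∈ I, ξ t • y t) ≤ ε ∧
      l2norm (posPart (P.C *ᵥ (∑ t ∈ I, ξ t • y t) - P.b)) ≤ ε / R := by
  have hdom := P.sum_smul_mem_dom hξ0 hξ1 fun t ht => (hy t ht).mem_dom
  have hU := P.sum_mul_U_le hξ0 hξ1 fun t ht => (hy t ht).mem_dom
  set xh := ∑ t ∈ I, ξ t • y t with hxh
  have hres : ∑ t ∈ I, ξ t • (P.b - P.C *ᵥ y t) = P.b - P.C *ᵥ xh := by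
    simp only [smul_sub, Finset.sum_sub_distrib, ← Finset.sum_smul, hξ1, one_smul, hxh,
      Matrix.mulVec_sum, Matrix.mulVec_smul]
  have hmain : ∀ z ∈ P.dom, ∀ v ∈ orthantBall m (2 * R),
      P.U z + lopt ⬝ᵥ (P.b - P.C *ᵥ z) - P.U xh + (P.C *ᵥ xh - P.b) ⬝ᵥ v ≤ ε := by
    intro z hz v hv
    have h1 : P.U z + lopt ⬝ᵥ (P.b - P.C *ᵥ z) ≤
        ∑ t ∈ I, ξ t * (P.U (y t) + l t ⬝ᵥ (P.b - P.C *ᵥ y t)) := by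
      calc P.U z + lopt ⬝ᵥ (P.b - P.C *ᵥ z)
          = ∑ t ∈ I, ξ t * (P.U z + lopt ⬝ᵥ (P.b - P.C *ᵥ z)) := by
            rw [← Finset.sum_mul, hξ1, one_mul]
        _ ≤ _ := Finset.sum_le_sum fun t ht =>
            mul_le_mul_of_nonneg_left (hlopt.le (hl t ht) (hy t ht) hz) (hξ0 t ht)
    have h2 := hcert v hv
    have h3 : (P.C *ᵥ xh - P.b) ⬝ᵥ v = -∑ t ∈ I, ξ t * ((P.b - P.C *ᵥ y t) ⬝ᵥ v) := by
      rw [← neg_sub, ← hres, neg_dotProduct, sum_dotProduct]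
      simp [smul_dotProduct]
    simp only [dotProduct_sub _ (l _), mul_sub, Finset.sum_sub_distrib] at h2
    simp only [mul_add, Finset.sum_add_distrib, dotProduct_comm (l _)] at h1
    rw [h3]
    linarith
  constructor
  -- Optimality gap: take `z` primal optimal and `v = 0`.
  · have h1 := hmain xopt hxopt.1.1 0 (zero_mem_orthantBall (by positivity))
    have h2 : 0 ≤ lopt ⬝ᵥ (P.b - P.C *ᵥ xopt) :=
      dotProduct_nonneg_of_nonneg hlopt.1 fun j => sub_nonneg.2 (hxopt.1.2 j)
    rw [dotProduct_zero] at h1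
    linarith
  -- Infeasibility: with `z = xh` the utilities cancel. The best `v` gains `2R` times the violation,
  -- the optimal multiplier costs at most `R` times it.
  · obtain ⟨v, hv, hvx⟩ := exists_mem_orthantBall_dotProduct_eq (r := 2 * R) (by positivity)
      (P.C *ᵥ xh - P.b)
    have h1 := hmain xh hdom v hv
    have h2 := dotProduct_le_posPart hlopt.1 (P.C *ᵥ xh - P.b)
    have h3 := mul_le_mul_of_nonneg_right hloptR (l2norm_nonneg (posPart (P.C *ᵥ xh - P.b)))
    rw [← neg_sub (P.C *ᵥ xh), dotProduct_neg, hvx] at h1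
    rw [le_div_iff₀ hR]
    linarith

end Average

/-! ### The size of the weights -/

lemma mem_productive {X : Set (Fin m → ℝ)} {s : ℕ → State m} {N t : ℕ} :
    t ∈ productive X s N ↔ t < N ∧ (s t).l ∈ interior X := by
  simp [productive]

lemma sum_productive_le {X : Set (Fin m → ℝ)} {s : ℕ → State m} {N : ℕ} {f : ℕ → ℝ}
    (hf : ∀ t < N, (s t).l ∉ interior X → 0 ≤ f t) :
    ∑ t ∈ productive X s N, f t ≤ ∑ t ∈ Finset.range N, f t :=
  Finset.sum_le_sum_of_subset_of_nonneg
    (fun _ ht => Finset.mem_range.2 (mem_productive.1 ht).1) fun t ht htI =>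
    hf t (Finset.mem_range.1 ht) fun h => htI (mem_productive.2 ⟨Finset.mem_range.1 ht, h⟩)

/-- If a nonnegative combination of cuts certifies that `⟨w, · - c⟩` is large at a point of the
set, the weight of its productive steps is large. -/
lemma neg_le_sum_productive {X : Set (Fin m → ℝ)} {s : ℕ → State m} {N : ℕ} {c : ℕ → ℝ}
    {g : ℕ → Fin m → ℝ} {M r a : ℝ} {y : Fin m → ℝ} (hc : ∀ t, 0 ≤ c t) (hM : 0 ≤ M)
    (hX : ∀ v ∈ X, l2norm v ≤ r) (hy : y ∈ X)
    (hg : ∀ t < N, (s t).l ∈ interior X → l2norm (g t) ≤ M)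
    (hsep : ∀ t < N, (s t).l ∉ interior X → 0 ≤ g t ⬝ᵥ ((s t).l - y))
    (hsum : ∑ t ∈ Finset.range N, c t * (g t ⬝ᵥ ((s t).l - y)) ≤ a) :
    -a ≤ M * (2 * r) * ∑ t ∈ productive X s N, c t := by
  have h1 := (sum_productive_le (X := X) (s := s) (f := fun t => c t * (g t ⬝ᵥ ((s t).l - y)))
    fun t ht h => mul_nonneg (hc t) (hsep t ht h)).trans hsum
  rw [neg_le, Finset.mul_sum, ← Finset.sum_neg_distrib]
  refine le_trans (Finset.sum_le_sum fun t ht => ?_) h1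
  obtain ⟨htN, htI⟩ := mem_productive.1 ht
  have h2 := (abs_le.1 (abs_dotProduct_le (g t) ((s t).l - y))).1
  have h3 : l2norm (g t) * l2norm ((s t).l - y) ≤ M * (2 * r) := by
    refine mul_le_mul (hg t htN htI) ?_ (l2norm_nonneg _) hM
    linarith [l2norm_sub_le (s t).l y, hX _ (interior_subset htI), hX y hy]
  nlinarith [hc t]

end NUM

/-! ### The main theorem -/

theorem mainTheorem3 {m n : ℕ} (hm : 2 ≤ m) (P : NUM.Network m n)
    (R M ε : ℝ) (hR : 0 < R) (hε : 0 < ε) (hεM : ε < 128 * M * R)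
    (hSlater : P.Slater)
    (xopt : Fin n → ℝ) (hxopt : P.IsPrimalSolution xopt)
    (lopt : Fin m → ℝ) (hlopt : P.IsDualSolution lopt) (hloptR : NUM.l2norm lopt ≤ R)
    (x : (Fin m → ℝ) → Fin n → ℝ)
    (hx : ∀ l ∈ interior (NUM.orthantBall m (2 * R)), P.IsResponse l (x l))
    (hM : ∀ l ∈ interior (NUM.orthantBall m (2 * R)), NUM.l2norm (P.subgrad x l) ≤ M)
    (sep : (Fin m → ℝ) → Fin m → ℝ)
    (hsep : NUM.IsSeparationOracle (NUM.orthantBall m (2 * R)) sep)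
    (N : ℕ) (hN : N = 2 * m * (m + 1) * ⌈Real.log (32 * (4 * M * R) / ε)⌉₊)
    (s : ℕ → NUM.State m) (hs : s = NUM.ellipsoid (2 * R) (P.oracle R x sep))
    (h : Fin m → ℝ) (hh : NUM.IsStripVector (s N).B h)
    (I : Finset ℕ) (hI : I = NUM.productive (NUM.orthantBall m (2 * R)) s N)
    (ξ : ℕ → ℝ)
    (hξ : ξ = NUM.certificate (NUM.orthantBall m (2 * R)) s
      (fun t => P.oracle R x sep (s t).l) h N)
    (xhat : Fin n → ℝ) (hxhat : xhat = ∑ t ∈ I, ξ t • x (s t).l) :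
    ((∀ t ∈ Finset.range N, 0 ≤ ξ t) ∧ ∑ t ∈ Finset.range N, ξ t = 1 ∧ ∑ t ∈ I, ξ t = 1) ∧
    xhat ∈ P.dom ∧
    P.U xopt - P.U xhat ≤ ε ∧
    NUM.l2norm (fun j => max ((P.C *ᵥ xhat - P.b) j) 0) ≤ ε / R := by
  set X := NUM.orthantBall m (2 * R) with hXdef
  set g : ℕ → Fin m → ℝ := fun t => P.oracle R x sep (s t).l with hgdef
  have hM0 : 0 < M := by
    by_contra! hcon
    nlinarith
  -- `ε < 128MR` forces `K ≥ 1`, so `N - 1` is a genuine index.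
  have hK1 : 0 < Real.log (32 * (4 * M * R) / ε) :=
    Real.log_pos ((one_lt_div hε).2 (by linarith))
  set K := ⌈Real.log (32 * (4 * M * R) / ε)⌉₊ with hK
  have hK0 : 1 ≤ K := Nat.ceil_pos.2 hK1
  have hN0 : 0 < N := by rw [hN]; positivity
  have hgin : ∀ t, (s t).l ∈ interior X → g t = P.b - P.C *ᵥ x (s t).l := fun t ht => by
    simp only [hgdef, NUM.Network.oracle]
    rw [if_pos ht, NUM.Network.subgrad]
  have hgM : ∀ t, (s t).l ∈ interior X → NUM.l2norm (g t) ≤ M := fun t ht => by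
    rw [hgin t ht]; exact hM _ ht
  have hgout : ∀ t, (s t).l ∉ interior X → g t = sep (s t).l := fun t ht => by
    simp only [hgdef, NUM.Network.oracle]
    exact if_neg ht
  have hgsep : ∀ t, (s t).l ∉ interior X → ∀ y ∈ X, 0 ≤ g t ⬝ᵥ ((s t).l - y) := fun t ht => by
    rw [hgout t ht]; exact (hsep _ ht).2
  have hIN : ∀ t ∈ I, t < N ∧ (s t).l ∈ interior X := fun t ht =>
    NUM.mem_productive.1 (hI ▸ ht)
  suffices hcert : (∀ t, 0 ≤ ξ t) ∧ (∀ t, t ∉ I → ξ t = 0) ∧ ∑ t ∈ I, ξ t = 1 ∧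
      ∀ z ∈ X, ∑ t ∈ I, ξ t * (g t ⬝ᵥ ((s t).l - z)) ≤ ε by
    obtain ⟨hξ0, hξI, hξ1, hξc⟩ := hcert
    have hsub : I ⊆ Finset.range N := fun t ht => Finset.mem_range.2 (hIN t ht).1
    have hresp : ∀ t ∈ I, P.IsResponse (s t).l (x (s t).l) := fun t ht => hx _ (hIN t ht).2
    refine ⟨⟨fun t _ => hξ0 t, ?_, hξ1⟩, ?_, ?_⟩
    · rw [← hξ1]
      exact (Finset.sum_subset hsub fun t _ ht => hξI t ht).symm
    · rw [hxhat]
      exact P.sum_smul_mem_dom (fun t _ => hξ0 t) hξ1 fun t ht => (hresp t ht).mem_dom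
    · rw [hxhat]
      refine NUM.Network.approx_of_certificate hR hxopt hlopt hloptR (fun t _ => hξ0 t) hξ1
        (l := fun t => (s t).l) (fun t ht => (interior_subset (hIN t ht).2).1) hresp
        fun z hz => ?_
      refine le_trans (le_of_eq (Finset.sum_congr rfl fun t ht => ?_)) (hξc z hz)
      rw [hgin t (hIN t ht).2]
  by_cases hlast : g (N - 1) = 0
  · have hξ' : ξ = fun t => if t = N - 1 then 1 else 0 := by
      rw [hξ]; funext t; rw [NUM.certificate, if_pos hlast]
    -- Separators are nonzero, so a zero vector can only be a dual subgradient.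
    have hmem : N - 1 ∈ I := by
      rw [hI, NUM.mem_productive]
      refine ⟨by omega, ?_⟩
      by_contra hcon
      exact (hsep _ hcon).1 (by rw [← hgout _ hcon]; exact hlast)
    refine ⟨fun t => ?_, fun t ht => ?_, ?_, fun z _ => ?_⟩
    · rw [hξ']; dsimp only; split_ifs <;> norm_num
    · rw [hξ']; exact if_neg fun heq : t = N - 1 => ht (heq ▸ hmem)
    · simp [hξ', hmem]
    · simp only [hξ', ite_mul, one_mul, zero_mul, Finset.sum_ite_eq', hmem, if_true, hlast,
        zero_dotProduct]
      exact hε.le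
  have hgne : ∀ t < N, P.oracle R x sep (NUM.ellipsoid (2 * R) (P.oracle R x sep) t).l ≠ 0 := by
    intro t ht h0
    apply hlast
    simp only [hgdef, hs]
    exact NUM.ellipsoid_stays (by omega) h0
  set B : ℕ → Matrix (Fin m) (Fin m) ℝ := fun i => (s i).B with hB
  set ν := NUM.coeffs B g N h with hν
  set μ := NUM.coeffs B g N (-h) with hμ
  have hν0 : ∀ t, 0 ≤ ν t := NUM.coeffs_nonneg B g N h
  have hμ0 : ∀ t, 0 ≤ μ t := NUM.coeffs_nonneg B g N (-h)
  have hX2 : ∀ y ∈ X, NUM.l2norm y ≤ 2 * R := fun y hy => hy.2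
  have hstrip : NUM.l2norm ((s N).Bᵀ *ᵥ h) = 1 / 2 ∧
      1 / (2 * (2 * R * Real.exp (-K))) ≤ NUM.l2norm h := by
    refine hh.bounds (by positivity) ?_
    obtain ⟨h1, h2⟩ := NUM.det_ellipsoid hm (r := 2 * R) (by positivity) N hgne
    rw [hs, abs_of_pos h1]
    refine h2.trans (le_of_eq ?_)
    -- `N / (2(m + 1)) = mK`: each semi-axis shrinks by `exp (-K)` in geometric mean.
    rw [mul_pow _ (Real.exp _), mul_comm ((2 * R) ^ m), ← Real.exp_nat_mul, ← Real.exp_nat_mul, hN]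
    congr 2
    push_cast
    field_simp
  have hsν : ∀ y ∈ X, ∑ t ∈ Finset.range N, ν t * (g t ⬝ᵥ ((s t).l - y)) ≤
      1 / 2 + h ⬝ᵥ ((s N).l - y) := fun y hy => by
    rw [← hstrip.1]
    exact NUM.sum_coeffs_le hm (by positivity) _ hs N h (hX2 y hy)
  have hsμ : ∀ y ∈ X, ∑ t ∈ Finset.range N, μ t * (g t ⬝ᵥ ((s t).l - y)) ≤
      1 / 2 - h ⬝ᵥ ((s N).l - y) := fun y hy => by
    have := NUM.sum_coeffs_le hm (by positivity) _ hs N (-h) (hX2 y hy)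
    rwa [Matrix.mulVec_neg, NUM.l2norm_neg, hstrip.1, neg_dotProduct, ← sub_eq_add_neg] at this
  set ω := ∑ t ∈ I, (ν t + μ t) with hω
  have hsum : ∀ y ∈ X, ∑ t ∈ I, (ν t + μ t) * (g t ⬝ᵥ ((s t).l - y)) ≤ 1 := fun y hy => by
    rw [hI]
    refine (NUM.sum_productive_le fun t _ ht =>
      mul_nonneg (add_nonneg (hν0 t) (hμ0 t)) (hgsep t ht y hy)).trans ?_
    simp only [add_mul, Finset.sum_add_distrib]
    linarith [hsν y hy, hsμ y hy]
  have hωε : 1 ≤ ω * ε := by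
    obtain ⟨y, hy, hwidth⟩ :=
      NUM.exists_mem_orthantBall_abs_dotProduct_ge (r := 2 * R) (by positivity) h (s N).l
    have hE : 0 < Real.exp K := Real.exp_pos _
    have hE1 : 128 * (M * R) ≤ ε * Real.exp K := by
      have h1 : 32 * (4 * M * R) / ε ≤ Real.exp K := by
        rw [← Real.log_le_iff_le_exp (by positivity)]
        exact Nat.le_ceil _
      rw [div_le_iff₀ hε] at h1
      linarith
    -- Any bound above `16 / 7` would do: it gives `exp K / 4 - 1 / 2 ≥ exp K / 32`, whence the
    -- factor 32 in `N`.
    have hE2 : 2.7 ≤ Real.exp K := by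
      have h1 : Real.exp 1 ≤ Real.exp K := Real.exp_le_exp.2 (by exact_mod_cast hK0)
      linarith [Real.exp_one_gt_d9]
    have hE3 : Real.exp K / 4 ≤ R * NUM.l2norm h := by
      refine le_trans (le_of_eq ?_) (mul_le_mul_of_nonneg_left hstrip.2 hR.le)
      rw [Real.exp_neg]
      field_simp
      norm_num
    have hνI : ∑ t ∈ I, ν t ≤ ω :=
      Finset.sum_le_sum fun t _ => le_add_of_nonneg_right (hμ0 t)
    have hμI : ∑ t ∈ I, μ t ≤ ω :=
      Finset.sum_le_sum fun t _ => le_add_of_nonneg_left (hν0 t)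
    have hMR : 0 < M * (2 * (2 * R)) := by positivity
    have hfin : Real.exp K / 4 - 1 / 2 ≤ M * (2 * (2 * R)) * ω := by
      -- The side of the strip beyond which `y` lies decides whether `μ` or `ν` alone already
      -- carries enough weight.
      rcases le_total 0 (h ⬝ᵥ ((s N).l - y)) with hsign | hsign
      · rw [abs_of_nonneg hsign] at hwidth
        have := NUM.neg_le_sum_productive hμ0 hM0.le hX2 hy (fun t _ => hgM t)
          (fun t _ ht => hgsep t ht y hy) (hsμ y hy)
        rw [← hI] at this
        linarith [mul_le_mul_of_nonneg_left hμI hMR.le]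
      · rw [abs_of_nonpos hsign] at hwidth
        have := NUM.neg_le_sum_productive hν0 hM0.le hX2 hy (fun t _ => hgM t)
          (fun t _ ht => hgsep t ht y hy) (hsν y hy)
        rw [← hI] at this
        linarith [mul_le_mul_of_nonneg_left hνI hMR.le]
    have hω0 : 0 < ω := pos_of_mul_pos_right (by linarith : 0 < M * (2 * (2 * R)) * ω) hMR.le
    have h1 := mul_le_mul_of_nonneg_right hE1 hω0.le
    have h2 : Real.exp K * 1 ≤ Real.exp K * (ω * ε) := by linarith
    exact le_of_mul_le_mul_left h2 hE
  have hω0 : 0 < ω := pos_of_mul_pos_left (by linarith : 0 < ω * ε) hε.le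
  have hξ' : ∀ t, ξ t = if t ∈ I then (ν t + μ t) / ω else 0 := by
    intro t
    rw [hξ, NUM.certificate, if_neg hlast, ← hI]
  have hξI : ∀ t ∈ I, ξ t = (ν t + μ t) / ω := fun t ht => by rw [hξ', if_pos ht]
  refine ⟨fun t => ?_, fun t ht => by rw [hξ', if_neg ht], ?_, fun z hz => ?_⟩
  · rw [hξ']
    split_ifs
    · exact div_nonneg (add_nonneg (hν0 t) (hμ0 t)) hω0.le
    · exact le_rfl
  · rw [Finset.sum_congr rfl hξI, ← Finset.sum_div, ← hω, div_self hω0.ne']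
  · rw [Finset.sum_congr rfl fun t ht => by rw [hξI t ht, div_mul_eq_mul_div], ← Finset.sum_div,
      div_le_iff₀ hω0]
    linarith [hsum z hz]
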